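/- Let $\Omega\subset\mathbb R^n$ be closed and convex (for instance $\Omega=[-1,1]^n$ or $\Omega=\mathbb R^n$), let $S\subset\Omega$ be Borel measurable and countably $1$-rectifiable (i.e. $S=\bigcup_{i\in\mathbb N} f_i(A_i)$ with $A_i\subset\mathbb R$ bounded and $f_i:A_i\to\mathbb R^n$ Lipschitz), let $a\in[0,\infty]$, and let $b:S\to[0,a]$ be lower semi-continuous. For $x,y\in\Omega$ define the generalized urban metric $$d_{S,a,b}(x,y)=\inf_{\gamma}\left(\int_{\gamma([0,1])\cap S}b\,\mathrm d\mathcal H^1+a\,\mathcal H^1(\gamma([0,1])\setminus S)\right)\in[0,\infty],$$ where $\mathcal H^1$ is the one-dimensional Hausdorff measure, $\infty\cdot 0=0$, and the infimum is over all Lipschitz paths $\gamma:[0,1]\to\Omega$ with $\gamma(0)=x$, $\gamma(1)=y$. If $a<\infty$, then $d_{S,a,b}:\Omega\times\Omega\to[0,\infty]$ is continuous. If $a=\infty$ and $\mathcal H^1(\{z\in S: b(z)\le\lambda\})<\infty$ for all $\lambda\in[0,\infty)$, then $d_{S,a,b}:\Omega\times\Omega\to[0,\infty]$ is lower semi-continuous.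 -/

import Mathlib

open Set MeasureTheory
open scoped ENNReal NNReal

/-- `S` is countably `1`-rectifiable: a countable union of Lipschitz images of bounded subsets
of the line (the sets `A i` may be empty). -/
def IsCountablyOneRectifiable {n : ℕ} (S : Set (EuclideanSpace ℝ (Fin n))) : Prop :=
  ∃ (A : ℕ → Set ℝ) (f : ℕ → ℝ → EuclideanSpace ℝ (Fin n)),
    (∀ i, Bornology.IsBounded (A i)) ∧
    (∀ i, ∃ K : ℝ≥0, LipschitzOnWith K (f i) (A i)) ∧
    S = ⋃ i, f i '' A i

/-- The Lipschitz paths `γ : [0,1] → Ω` with `γ 0 = x` and `γ 1 = y`. -/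
def lipschitzPaths {n : ℕ} (Ω : Set (EuclideanSpace ℝ (Fin n)))
    (x y : EuclideanSpace ℝ (Fin n)) : Set (unitInterval → EuclideanSpace ℝ (Fin n)) :=
  {γ | (∃ K : ℝ≥0, LipschitzWith K γ) ∧ (∀ t, γ t ∈ Ω) ∧ γ 0 = x ∧ γ 1 = y}

/-- The cost of a set `T` (the image of a path): the integral of `b` over `T ∩ S` with respect to
the one-dimensional Hausdorff measure plus `a` times the Hausdorff measure of `T \ S`
(with `∞ * 0 = 0`). Only the values of `b` on `S` matter. -/
noncomputable def travelCost {n : ℕ} (S : Set (EuclideanSpace ℝ (Fin n))) (a : ℝ≥0∞)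
    (b : EuclideanSpace ℝ (Fin n) → ℝ≥0∞) (T : Set (EuclideanSpace ℝ (Fin n))) : ℝ≥0∞ :=
  (∫⁻ z in T ∩ S, b z ∂(Measure.hausdorffMeasure 1)) + a * Measure.hausdorffMeasure 1 (T \ S)

/-- The generalized urban metric `d_{S,a,b}`, with paths running in `Ω`. -/
noncomputable def urbanMetric {n : ℕ} (Ω S : Set (EuclideanSpace ℝ (Fin n))) (a : ℝ≥0∞)
    (b : EuclideanSpace ℝ (Fin n) → ℝ≥0∞) (x y : EuclideanSpace ℝ (Fin n)) : ℝ≥0∞ :=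
  ⨅ γ ∈ lipschitzPaths Ω x y, travelCost S a b (range γ)

/-- The sublevel sets `{z ∈ S | b z ≤ l}` have finite one-dimensional Hausdorff measure for all
`l ∈ [0, a)`. -/
def FiniteSublevels {n : ℕ} (S : Set (EuclideanSpace ℝ (Fin n))) (a : ℝ≥0∞)
    (b : EuclideanSpace ℝ (Fin n) → ℝ≥0∞) : Prop :=
  ∀ l : ℝ≥0∞, l < a → Measure.hausdorffMeasure 1 {z ∈ S | b z ≤ l} < ∞

/-!
For finite `a` the metric satisfies the triangle inequality and, along segments, is at most `a`
times the Euclidean distance; hence it is Lipschitz.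

Lower semicontinuity is the direct method. Take paths of bounded cost whose end points converge.
Passing to a path of least Lipschitz constant inside the image of each of them removes all loops,
and an injective path can be reparametrized so that its Lipschitz constant is the Hausdorff measure
of its image. These measures are bounded, because where the density is small the measure is finite
and elsewhere the cost controls the length, so Arzelà–Ascoli yields a uniform limit path. As the
paths have the least possible Lipschitz constant, they lose no measure anywhere, which gives Gołąb's
inequality `ℋ¹(γ₀ ∩ U) ≤ liminf ℋ¹(γₖ ∩ U)` for open `U`. Superlevel sets of the density are
complements of sets of finite measure, hence open up to arbitrarily small measure, and the layer
cake formula turns the resulting inequalities into lower semicontinuity of the cost.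
-/

open Filter Topology

section Gluing

variable {X : Type*} [PseudoMetricSpace X]

theorem lipschitzWith_ite_le {K : ℝ≥0} {f g : ℝ → X} {s : ℝ} (hf : LipschitzWith K f)
    (hg : LipschitzWith K g) (hfg : f s = g s) :
    LipschitzWith K (fun r => if r ≤ s then f r else g r) := by
  have dist_across : ∀ u v : ℝ, u ≤ s → s < v → dist (f u) (g v) ≤ K * dist u v := by
    intro u v hu hv
    calc dist (f u) (g v) ≤ dist (f u) (f s) + dist (g s) (g v) := by
          simpa only [hfg] using dist_triangle (f u) (f s) (g v)
      _ ≤ K * dist u s + K * dist s v := add_le_add (hf.dist_le_mul _ _) (hg.dist_le_mul _ _)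
      _ = K * dist u v := by
        rw [← mul_add, Real.dist_eq, Real.dist_eq, Real.dist_eq, abs_of_nonpos (by linarith),
          abs_of_neg (by linarith), abs_of_neg (by linarith)]
        ring
  refine LipschitzWith.of_dist_le_mul fun u v => ?_
  split_ifs with hu hv hv
  · exact hf.dist_le_mul _ _
  · exact dist_across u v hu (not_le.1 hv)
  · simpa only [dist_comm] using dist_across v u hv (not_le.1 hu)
  · exact hg.dist_le_mul _ _

theorem lipschitzWith_iccExtend {K : ℝ≥0} {γ : unitInterval → X} (hγ : LipschitzWith K γ) :
    LipschitzWith K (IccExtend zero_le_one γ) := by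
  simpa only [mul_one] using! hγ.comp (LipschitzWith.projIcc (zero_le_one (α := ℝ)))

theorem lipschitzWith_comp_add_right {K : ℝ≥0} {F : ℝ → X} (hF : LipschitzWith K F) (c : ℝ) :
    LipschitzWith K (fun r => F (r + c)) := by
  simpa only [mul_one] using! hF.comp (isometry_add_right c).lipschitz

theorem exists_lipschitzWith_comp_eq_of_surjective {α Y : Type*} [MetricSpace Y] {K : ℝ≥0}
    {f : α → Y} {φ : α → X} (hφ : Function.Surjective φ)
    (h : ∀ s t, dist (f s) (f t) ≤ K * dist (φ s) (φ t)) :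
    ∃ g : X → Y, LipschitzWith K g ∧ g ∘ φ = f := by
  refine ⟨f ∘ Function.surjInv hφ, LipschitzWith.of_dist_le_mul fun u v => ?_, funext fun t => ?_⟩
  · simpa only [Function.comp_apply, Function.surjInv_eq hφ] using
      h (Function.surjInv hφ u) (Function.surjInv hφ v)
  · have := h (Function.surjInv hφ (φ t)) t
    rw [Function.surjInv_eq hφ, dist_self, mul_zero] at this
    exact dist_le_zero.1 this

end Gluing

section Paths

variable {X : Type*} [MetricSpace X] {Ω Ω' : Set X} {K K' : ℝ≥0} {x y z : X}
  {γ γ' : unitInterval → X}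

/-- `γ` is a `K`-Lipschitz path in `Ω` from `x` to `y`. This is the notion of `lipschitzPaths` in an
arbitrary metric space, with the Lipschitz constant made explicit because it is minimized below. -/
structure IsLipschitzPath (K : ℝ≥0) (Ω : Set X) (x y : X) (γ : unitInterval → X) : Prop where
  lipschitzWith : LipschitzWith K γ
  mem : ∀ t, γ t ∈ Ω
  source : γ 0 = x
  target : γ 1 = y

namespace IsLipschitzPath

theorem mono (h : IsLipschitzPath K Ω x y γ) (hΩ : Ω ⊆ Ω') : IsLipschitzPath K Ω' x y γ :=
  { h with mem := fun t => hΩ (h.mem t) }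

theorem in_range (h : IsLipschitzPath K Ω x y γ) : IsLipschitzPath K (range γ) x y γ :=
  { h with mem := mem_range_self }

theorem range_subset (h : IsLipschitzPath K Ω x y γ) : range γ ⊆ Ω :=
  range_subset_iff.2 h.mem

theorem isCompact_range (h : IsLipschitzPath K Ω x y γ) : IsCompact (range γ) :=
  _root_.isCompact_range h.lipschitzWith.continuous

theorem const (hx : x ∈ Ω) : IsLipschitzPath 0 Ω x x fun _ => x :=
  ⟨LipschitzWith.const x, fun _ => hx, rfl, rfl⟩

theorem comp_mul {F : ℝ → X} (hF : LipschitzWith K F) (c : ℝ≥0) :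
    IsLipschitzPath (K * c) (range F) (F 0) (F c) fun t => F (c * t) where
  lipschitzWith := by
    simpa using! (hF.comp (lipschitzWith_smul (c : ℝ))).comp
      (LipschitzWith.subtype_val unitInterval)
  mem _ := mem_range_self _
  source := by simp
  target := by simp

theorem lineMap {E : Type*} [NormedAddCommGroup E] [NormedSpace ℝ E] {Ω : Set E}
    (hΩ : Convex ℝ Ω) {x y : E} (hx : x ∈ Ω) (hy : y ∈ Ω) :
    IsLipschitzPath (nndist x y) Ω x y fun t => AffineMap.lineMap (k := ℝ) x y (t : ℝ) where
  lipschitzWith := by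
    simpa using! (lipschitzWith_lineMap (𝕜 := ℝ) x y).comp (LipschitzWith.subtype_val unitInterval)
  mem t := hΩ.lineMap_mem hx hy t.2
  source := by simp
  target := by simp

theorem exists_concat (h : IsLipschitzPath K Ω x y γ) (h' : IsLipschitzPath K' Ω' y z γ') :
    ∃ (C : ℝ≥0) (η : unitInterval → X), IsLipschitzPath C (Ω ∪ Ω') x z η := by
  have hglue := lipschitzWith_ite_le (s := 1)
    (lipschitzWith_iccExtend (h.lipschitzWith.weaken (le_max_left K K')))
    (lipschitzWith_comp_add_right
      (lipschitzWith_iccExtend (h'.lipschitzWith.weaken (le_max_right K K'))) (-1))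
    (by simpa using! h.target.trans h'.source.symm)
  have hη := comp_mul hglue 2
  refine ⟨_, _, hη.lipschitzWith, fun t => ?_, hη.source.trans ?_, hη.target.trans ?_⟩
  · split_ifs
    · exact Or.inl (h.mem _)
    · exact Or.inr (h'.mem _)
  · simpa using! h.source
  · have : (2 : ℝ) + -1 = 1 := by norm_num
    simpa [this] using! h'.target

theorem exists_mul_lt_of_loop (h : IsLipschitzPath K Ω x y γ) {s t : unitInterval} (hst : s < t)
    (hloop : γ s = γ t) :
    ∃ (c : ℝ≥0) (η : unitInterval → X), c < 1 ∧ IsLipschitzPath (K * c) Ω x y η := by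
  have hst' : (s : ℝ) < t := hst
  have hs0 := s.2.1
  have ht1 := t.2.2
  have hext := lipschitzWith_iccExtend h.lipschitzWith
  have hglue := lipschitzWith_ite_le (s := s) hext (lipschitzWith_comp_add_right hext (t - s))
    (by simp only [add_sub_cancel, IccExtend_val, hloop])
  let c : ℝ≥0 := ⟨1 - (t - s), by linarith⟩
  have hη := comp_mul hglue c
  refine ⟨c, _, ?_, hη.lipschitzWith, fun u => ?_, hη.source.trans ?_, hη.target.trans ?_⟩
  · rw [← NNReal.coe_lt_coe]
    change 1 - ((t : ℝ) - s) < 1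
    linarith
  · split_ifs
    · exact h.mem _
    · exact h.mem _
  · simpa [hs0] using! h.source
  · change (if 1 - ((t : ℝ) - s) ≤ s then IccExtend zero_le_one γ (1 - (t - s))
      else IccExtend zero_le_one γ (1 - (t - s) + (t - s))) = y
    split_ifs with hle
    · have ht : t = 1 := Subtype.ext (by change (t : ℝ) = 1; linarith)
      have hs : 1 - ((t : ℝ) - s) = s := by simp [ht]
      rw [hs, IccExtend_val, hloop, ht, h.target]
    · rw [sub_add_cancel]
      simpa using! h.target

/-- Cutting out a loop would improve the Lipschitz constant. -/
theorem injective_of_isLeast (h : IsLipschitzPath K Ω x y γ) (hxy : x ≠ y)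
    (hK : K ∈ lowerBounds {D | ∃ η, IsLipschitzPath D Ω x y η}) : Function.Injective γ := by
  have hpos : 0 < K := by
    rw [pos_iff_ne_zero]
    rintro rfl
    have := h.lipschitzWith.dist_le_mul 0 1
    rw [h.source, h.target, NNReal.coe_zero, zero_mul] at this
    exact hxy (dist_le_zero.1 this)
  refine .of_lt_imp_ne fun s t hst hloop => ?_
  obtain ⟨c, η, hc, hη⟩ := h.exists_mul_lt_of_loop hst hloop
  exact (hK ⟨η, hη⟩).not_gt (mul_lt_of_lt_one_right hpos hc)

theorem mem_closedBall (h : IsLipschitzPath K Ω x y γ) (t : unitInterval) :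
    γ t ∈ Metric.closedBall x K := by
  rw [← h.source]
  refine (h.lipschitzWith.dist_le_mul t 0).trans (mul_le_of_le_one_right K.coe_nonneg ?_)
  rw [Subtype.dist_eq, Real.dist_eq, Icc.coe_zero, sub_zero, abs_of_nonneg t.2.1]
  exact t.2.2

theorem of_tendsto {ι : Type*} {u : Filter ι} [NeBot u] {l : ι → ℝ≥0} {p q : ι → X}
    {γs : ι → unitInterval → X} (hγs : ∀ k, IsLipschitzPath (l k) Ω (p k) (q k) (γs k))
    (hΩ : IsClosed Ω) (hl : Tendsto l u (𝓝 K)) (hp : Tendsto p u (𝓝 x)) (hq : Tendsto q u (𝓝 y))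
    (hγ : ∀ t, Tendsto (fun k => γs k t) u (𝓝 (γ t))) : IsLipschitzPath K Ω x y γ where
  lipschitzWith := LipschitzWith.of_dist_le_mul fun s t =>
    le_of_tendsto_of_tendsto' ((hγ s).dist (hγ t))
      (((NNReal.continuous_coe.tendsto _).comp hl).mul_const _)
      fun k => (hγs k).lipschitzWith.dist_le_mul s t
  mem t := hΩ.mem_of_tendsto (hγ t) (Eventually.of_forall fun k => (hγs k).mem t)
  source := tendsto_nhds_unique (hγ 0) (by simpa only [(hγs _).source] using hp)
  target := tendsto_nhds_unique (hγ 1) (by simpa only [(hγs _).target] using hq)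

end IsLipschitzPath

end Paths

section Compactness

variable {X : Type*} [MetricSpace X]

theorem exists_subseq_tendstoUniformly_of_lipschitzWith {Y : Type*} [PseudoMetricSpace Y]
    [CompactSpace Y] {s : Set X} (hs : IsCompact s) {L : ℝ≥0} {l : ℕ → ℝ≥0} (hl : ∀ k, l k ≤ L)
    {f : ℕ → Y → X} (hf : ∀ k, LipschitzWith (l k) (f k)) (hfs : ∀ k t, f k t ∈ s) :
    ∃ (φ : ℕ → ℕ) (l₀ : ℝ≥0) (f₀ : Y → X), StrictMono φ ∧
      Tendsto (l ∘ φ) atTop (𝓝 l₀) ∧ TendstoUniformly (f ∘ φ) f₀ atTop := by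
  let F : ℕ → BoundedContinuousFunction Y X := fun k =>
    BoundedContinuousFunction.mkOfCompact ⟨f k, (hf k).continuous⟩
  have hequi : Equicontinuous ((↑) : range F → Y → X) := by
    apply UniformEquicontinuous.equicontinuous
    refine LipschitzWith.uniformEquicontinuous _ L ?_
    rintro ⟨_, k, rfl⟩
    exact (hf k).weaken (hl k)
  have hcompact : IsCompact (closure (range F)) :=
    BoundedContinuousFunction.arzela_ascoli s hs (range F)
      (by rintro _ t ⟨k, rfl⟩; exact hfs k t) hequi
  obtain ⟨⟨l₀, f₀⟩, -, φ, hφ, hlim⟩ := ((isCompact_Icc (a := (0 : ℝ≥0)) (b := L)).prod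
    hcompact).tendsto_subseq (x := fun k => (l k, F k))
    (fun k => ⟨⟨zero_le, hl k⟩, subset_closure (mem_range_self k)⟩)
  exact ⟨φ, l₀, f₀, hφ, (continuous_fst.tendsto _).comp hlim,
    BoundedContinuousFunction.tendsto_iff_tendstoUniformly.1
      ((continuous_snd.tendsto (l₀, f₀)).comp hlim)⟩

theorem exists_isLeast_isLipschitzPath {Ω : Set X} (hΩ : IsCompact Ω) {K : ℝ≥0} {x y : X}
    {γ : unitInterval → X} (hγ : IsLipschitzPath K Ω x y γ) :
    ∃ D, IsLeast {D : ℝ≥0 | ∃ η, IsLipschitzPath D Ω x y η} D := by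
  set A : Set ℝ≥0 := {D | ∃ η, IsLipschitzPath D Ω x y η}
  obtain ⟨l, hanti, hlim, hlA⟩ :=
    exists_seq_tendsto_sInf (S := A) ⟨K, γ, hγ⟩ (OrderBot.bddBelow A)
  choose η hη using hlA
  obtain ⟨φ, l₀, η₀, hφ, hl₀, hu⟩ := exists_subseq_tendstoUniformly_of_lipschitzWith hΩ
    (fun k => hanti (Nat.zero_le k)) (fun k => (hη k).lipschitzWith) (fun k => (hη k).mem)
  have hinf : l₀ = sInf A := tendsto_nhds_unique hl₀ (hlim.comp hφ.tendsto_atTop)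
  refine ⟨sInf A, ⟨η₀, ?_⟩, fun D hD => csInf_le (OrderBot.bddBelow A) hD⟩
  exact hinf ▸ IsLipschitzPath.of_tendsto (fun k => hη (φ k)) hΩ.isClosed hl₀
    tendsto_const_nhds tendsto_const_nhds hu.tendsto_at

theorem exists_subseq_tendstoUniformly_of_isLipschitzPath [ProperSpace X] {Ω : Set X}
    (hΩ : IsClosed Ω) {L : ℝ≥0} {l : ℕ → ℝ≥0} (hl : ∀ k, l k ≤ L) {x y : X} {p q : ℕ → X}
    (hp : Tendsto p atTop (𝓝 x)) (hq : Tendsto q atTop (𝓝 y)) {γ : ℕ → unitInterval → X}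
    (hγ : ∀ k, IsLipschitzPath (l k) Ω (p k) (q k) (γ k)) :
    ∃ (φ : ℕ → ℕ) (l₀ : ℝ≥0) (γ₀ : unitInterval → X), Tendsto (l ∘ φ) atTop (𝓝 l₀) ∧
      TendstoUniformly (γ ∘ φ) γ₀ atTop ∧ IsLipschitzPath l₀ Ω x y γ₀ := by
  obtain ⟨R, hR⟩ := (Metric.isBounded_range_of_tendsto _ hp).subset_closedBall x
  have hball : ∀ k t, γ k t ∈ Metric.closedBall x (L + R) := fun k t =>
    (dist_triangle _ (p k) _).trans (add_le_add
      (((hγ k).mem_closedBall t).trans (NNReal.coe_le_coe.2 (hl k))) (hR (mem_range_self k)))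
  obtain ⟨φ, l₀, γ₀, hφ, hl₀, hu⟩ := exists_subseq_tendstoUniformly_of_lipschitzWith
    (isCompact_closedBall x (L + R)) hl (fun k => (hγ k).lipschitzWith) hball
  exact ⟨φ, l₀, γ₀, hl₀, hu, IsLipschitzPath.of_tendsto (fun k => hγ (φ k)) hΩ hl₀
    (hp.comp hφ.tendsto_atTop) (hq.comp hφ.tendsto_atTop) hu.tendsto_at⟩

end Compactness

section Length

theorem hausdorffMeasure_one_unitInterval : (μH[1] : Measure unitInterval) = volume := by
  ext s _
  rw [unitInterval.volume_apply, ← hausdorffMeasure_real,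
    (isometry_subtype_coe (s := unitInterval)).hausdorffMeasure_image (Or.inl zero_le_one)]

variable {X : Type*} [MetricSpace X] [MeasurableSpace X] [BorelSpace X] {K : ℝ≥0}
  {γ : unitInterval → X}

theorem hausdorffMeasure_one_image_le_mul_volume (hγ : LipschitzWith K γ) (s : Set unitInterval) :
    μH[1] (γ '' s) ≤ K * volume s := by
  simpa [hausdorffMeasure_one_unitInterval] using hγ.hausdorffMeasure_image_le zero_le_one s

theorem hausdorffMeasure_one_range_le (hγ : LipschitzWith K γ) : μH[1] (range γ) ≤ K := by
  simpa using hausdorffMeasure_one_image_le_mul_volume hγ univ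

theorem edist_le_hausdorffMeasure_one_of_isPreconnected {T : Set X} (hT : IsPreconnected T)
    {x y : X} (hx : x ∈ T) (hy : y ∈ T) : edist x y ≤ μH[1] T := by
  have hdist : LipschitzWith 1 (dist x) := LipschitzWith.dist_right x
  have hIcc : Icc 0 (dist x y) ⊆ dist x '' T := by
    simpa using (hT.image _ hdist.continuous.continuousOn).Icc_subset (mem_image_of_mem _ hx)
      (mem_image_of_mem _ hy)
  calc edist x y = μH[1] (Icc 0 (dist x y)) := by
        rw [hausdorffMeasure_real, Real.volume_Icc, sub_zero, edist_dist]
    _ ≤ μH[1] (dist x '' T) := measure_mono hIcc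
    _ ≤ μH[1] T := by simpa using hdist.hausdorffMeasure_image_le zero_le_one T

theorem hausdorffMeasure_one_image_Iic_add_image_Icc (hγ : Continuous γ)
    (hinj : Function.Injective γ) {s t : unitInterval} (hst : s ≤ t) :
    μH[1] (γ '' Iic s) + μH[1] (γ '' Icc s t) = μH[1] (γ '' Iic t) := by
  have := Measure.nullSingletonClass_hausdorff X (d := 1) zero_lt_one
  have hinter : γ '' Iic s ∩ γ '' Icc s t = {γ s} := by
    rw [← image_inter hinj, ← Ici_inter_Iic, ← inter_assoc, inter_comm (Iic s), Ici_inter_Iic,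
      Icc_self, singleton_inter_of_mem (mem_Iic.2 hst), image_singleton]
  rw [← measure_union₀ (isCompact_Icc.image hγ).measurableSet.nullMeasurableSet
    (by rw [AEDisjoint, hinter, measure_singleton]), ← image_union, Iic_union_Icc_eq_Iic hst]

/-- The fraction of the length of the image of `γ` that is covered up to time `t`, where length is
one-dimensional Hausdorff measure; it is the parameter of the constant speed reparametrization of an
injective path. It is constantly `0` if the total length is `0` or `∞`. -/
noncomputable def lengthFraction (γ : unitInterval → X) (t : unitInterval) : unitInterval :=
  ⟨(μH[1] (γ '' Iic t) / μH[1] (range γ)).toReal, ENNReal.toReal_nonneg,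
    ENNReal.toReal_mono ENNReal.one_ne_top <|
      ENNReal.div_le_of_le_mul <| by rw [one_mul]; exact measure_mono (image_subset_range γ _)⟩

theorem lengthFraction_zero : lengthFraction γ 0 = 0 := by
  have := Measure.nullSingletonClass_hausdorff X (d := 1) zero_lt_one
  have hIic : Iic (0 : unitInterval) = {0} := Iic_bot
  ext
  simp [lengthFraction, hIic]

theorem lengthFraction_one (h0 : μH[1] (range γ) ≠ 0) (htop : μH[1] (range γ) ≠ ∞) :
    lengthFraction γ 1 = 1 := by
  have hIic : Iic (1 : unitInterval) = univ := Iic_top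
  ext
  simp [lengthFraction, hIic, ENNReal.div_self h0 htop]

theorem length_mul_dist_lengthFraction (hγ : Continuous γ) (hinj : Function.Injective γ)
    (h0 : μH[1] (range γ) ≠ 0) (htop : μH[1] (range γ) ≠ ∞) (s t : unitInterval) :
    (μH[1] (range γ)).toReal * dist (lengthFraction γ s) (lengthFraction γ t) =
      (μH[1] (γ '' uIcc s t)).toReal := by
  wlog hst : s ≤ t generalizing s t
  · rw [dist_comm, uIcc_comm]
    exact this t s (le_of_not_ge hst)
  have hne : ∀ u : Set unitInterval, μH[1] (γ '' u) ≠ ∞ := fun u =>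
    ne_top_of_le_ne_top htop (measure_mono (image_subset_range γ u))
  have hM : (μH[1] (range γ)).toReal ≠ 0 := ENNReal.toReal_ne_zero.2 ⟨h0, htop⟩
  have hdiff : (μH[1] (range γ)).toReal * (lengthFraction γ t - lengthFraction γ s : ℝ) =
      (μH[1] (γ '' Icc s t)).toReal := by
    simp only [lengthFraction, ENNReal.toReal_div]
    rw [← hausdorffMeasure_one_image_Iic_add_image_Icc hγ hinj hst,
      ENNReal.toReal_add (hne _) (hne _)]
    field_simp
    ring
  have hnonneg : (0 : ℝ) ≤ lengthFraction γ t - lengthFraction γ s :=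
    nonneg_of_mul_nonneg_right (hdiff ▸ ENNReal.toReal_nonneg)
      (lt_of_le_of_ne ENNReal.toReal_nonneg hM.symm)
  rw [uIcc_of_le hst, ← hdiff, dist_comm, Subtype.dist_eq, Real.dist_eq, abs_of_nonneg hnonneg]

theorem continuous_lengthFraction (hγ : LipschitzWith K γ) (hinj : Function.Injective γ)
    (h0 : μH[1] (range γ) ≠ 0) (htop : μH[1] (range γ) ≠ ∞) : Continuous (lengthFraction γ) := by
  set M := (μH[1] (range γ)).toReal
  have hMpos : 0 < M := ENNReal.toReal_pos h0 htop
  refine (LipschitzWith.of_dist_le' (K := K / M) fun s t => ?_).continuous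
  rw [div_mul_eq_mul_div, le_div_iff₀' hMpos,
    length_mul_dist_lengthFraction hγ.continuous hinj h0 htop, dist_edist, ← ENNReal.coe_toReal,
    ← ENNReal.toReal_mul]
  refine ENNReal.toReal_mono (ENNReal.mul_ne_top ENNReal.coe_ne_top (edist_ne_top _ _)) ?_
  simpa only [unitInterval.volume_uIcc, edist_comm t] using
    hausdorffMeasure_one_image_le_mul_volume hγ (uIcc s t)

theorem dist_le_length_mul_dist_lengthFraction (hγ : Continuous γ) (hinj : Function.Injective γ)
    (h0 : μH[1] (range γ) ≠ 0) (htop : μH[1] (range γ) ≠ ∞) (s t : unitInterval) :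
    dist (γ s) (γ t) ≤
      (μH[1] (range γ)).toReal * dist (lengthFraction γ s) (lengthFraction γ t) := by
  rw [length_mul_dist_lengthFraction hγ hinj h0 htop, dist_edist]
  refine ENNReal.toReal_mono
    (ne_top_of_le_ne_top htop (measure_mono (image_subset_range γ _))) ?_
  exact edist_le_hausdorffMeasure_one_of_isPreconnected
    (isPreconnected_uIcc.image γ hγ.continuousOn)
    (mem_image_of_mem _ left_mem_uIcc) (mem_image_of_mem _ right_mem_uIcc)

namespace IsLipschitzPath

variable {Ω : Set X} {x y : X}

theorem exists_constant_speed_of_injective (h : IsLipschitzPath K Ω x y γ)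
    (hinj : Function.Injective γ) :
    ∃ η, IsLipschitzPath (μH[1] (range η)).toNNReal (range γ) x y η := by
  have htop : μH[1] (range γ) ≠ ∞ :=
    ne_top_of_le_ne_top ENNReal.coe_ne_top (hausdorffMeasure_one_range_le h.lipschitzWith)
  have h0 : μH[1] (range γ) ≠ 0 := by
    refine ((edist_pos.2 (hinj.ne zero_ne_one)).trans_le ?_).ne'
    exact edist_le_hausdorffMeasure_one_of_isPreconnected
      (isPreconnected_range h.lipschitzWith.continuous) (mem_range_self 0) (mem_range_self 1)
  have hφ0 : lengthFraction γ 0 = 0 := lengthFraction_zero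
  have hφ1 : lengthFraction γ 1 = 1 := lengthFraction_one h0 htop
  have hsurj : Function.Surjective (lengthFraction γ) := fun u => by
    refine intermediate_value_univ 0 1 (continuous_lengthFraction h.lipschitzWith hinj h0 htop) ?_
    rw [hφ0, hφ1]
    exact u.2
  obtain ⟨η, hη, hηγ⟩ := exists_lipschitzWith_comp_eq_of_surjective
    (K := (μH[1] (range γ)).toNNReal) hsurj
    (dist_le_length_mul_dist_lengthFraction h.lipschitzWith.continuous hinj h0 htop)
  have hrange : range η = range γ := by rw [← hηγ, hsurj.range_comp]
  refine ⟨η, hrange ▸ hη, fun t => hrange ▸ mem_range_self t, ?_, ?_⟩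
  · rw [← h.source, ← hηγ, Function.comp_apply, hφ0]
  · rw [← h.target, ← hηγ, Function.comp_apply, hφ1]

theorem exists_constant_speed (h : IsLipschitzPath K Ω x y γ) :
    ∃ η, IsLipschitzPath (μH[1] (range η)).toNNReal (range γ) x y η := by
  rcases eq_or_ne x y with rfl | hxy
  · have hconst := const (h.source ▸ mem_range_self 0 : x ∈ range γ)
    exact ⟨_, { hconst with lipschitzWith := hconst.lipschitzWith.weaken zero_le }⟩
  · obtain ⟨D, ⟨ζ, hζ⟩, hD⟩ := exists_isLeast_isLipschitzPath h.isCompact_range h.in_range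
    obtain ⟨η, hη⟩ := hζ.exists_constant_speed_of_injective (hζ.injective_of_isLeast hxy hD)
    exact ⟨η, hη.mono hζ.range_subset⟩

end IsLipschitzPath

theorem mul_volume_le_hausdorffMeasure_one_image (hγ : LipschitzWith K γ)
    (hK : K ≤ μH[1] (range γ)) {s : Set unitInterval} (hs : MeasurableSet s) :
    K * volume s ≤ μH[1] (γ '' s) := by
  have hfin : K * volume sᶜ ≠ ∞ := ENNReal.mul_ne_top ENNReal.coe_ne_top (measure_ne_top _ _)
  refine (ENNReal.add_le_add_iff_right hfin).1 ?_
  calc K * volume s + K * volume sᶜ = K := by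
        rw [← mul_add, measure_add_measure_compl hs, measure_univ, mul_one]
    _ ≤ μH[1] (γ '' s ∪ γ '' sᶜ) := by rwa [← image_union, union_compl_self, image_univ]
    _ ≤ μH[1] (γ '' s) + μH[1] (γ '' sᶜ) := measure_union_le _ _
    _ ≤ μH[1] (γ '' s) + K * volume sᶜ := by
      gcongr
      exact hausdorffMeasure_one_image_le_mul_volume hγ _

/-- Gołąb's inequality, in the form localized to an open set. -/
theorem hausdorffMeasure_one_range_inter_le_liminf {ι : Type*} {u : Filter ι} [NeBot u]
    {l : ι → ℝ≥0} {l₀ : ℝ≥0} {γs : ι → unitInterval → X}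
    (hγs : ∀ k, LipschitzWith (l k) (γs k)) (hl : ∀ k, l k ≤ μH[1] (range (γs k)))
    (hlim : Tendsto l u (𝓝 l₀)) (hγ : LipschitzWith l₀ γ) (hu : TendstoUniformly γs γ u)
    {U : Set X} (hU : IsOpen U) :
    μH[1] (range γ ∩ U) ≤ liminf (fun k => μH[1] (range (γs k) ∩ U)) u := by
  suffices hcompact : ∀ C ⊆ γ ⁻¹' U, IsCompact C →
      l₀ * volume C ≤ liminf (fun k => μH[1] (range (γs k) ∩ U)) u by
    calc μH[1] (range γ ∩ U) ≤ l₀ * volume (γ ⁻¹' U) := by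
          rw [inter_comm, ← image_preimage_eq_inter_range]
          exact hausdorffMeasure_one_image_le_mul_volume hγ _
      _ ≤ liminf (fun k => μH[1] (range (γs k) ∩ U)) u := by
          rw [(hU.preimage hγ.continuous).measure_eq_iSup_isCompact]
          simpa only [ENNReal.mul_iSup, iSup_le_iff] using hcompact
  intro C hCU hC
  obtain ⟨δ, hδ, hthick⟩ := (hC.image hγ.continuous).exists_thickening_subset_open hU
    (image_subset_iff.2 hCU)
  have hsub : ∀ᶠ k in u, γs k '' C ⊆ range (γs k) ∩ U := by
    filter_upwards [Metric.tendstoUniformly_iff.1 hu δ hδ] with k hk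
    rintro _ ⟨t, ht, rfl⟩
    exact ⟨mem_range_self _, hthick (Metric.mem_thickening_iff.2
      ⟨γ t, mem_image_of_mem _ ht, dist_comm (γ t) (γs k t) ▸ hk t⟩)⟩
  have hmul : Tendsto (fun k => l k * volume C) u (𝓝 (l₀ * volume C)) :=
    ENNReal.Tendsto.mul_const (ENNReal.tendsto_coe.2 hlim) (Or.inr (measure_ne_top _ _))
  rw [← hmul.liminf_eq]
  refine liminf_le_liminf ?_
  filter_upwards [hsub] with k hk
  exact (mul_volume_le_hausdorffMeasure_one_image (hγs k) (hl k) hC.measurableSet).trans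
    (measure_mono hk)

end Length

section MeasureLimits

variable {X : Type*} [MeasurableSpace X] {μ : Measure X}

theorem lintegral_ofReal_le_liminf_of_superlevel {μs : ℕ → Measure X} {g : X → ℝ}
    (hg : Measurable g) (hg0 : 0 ≤ g)
    (h : ∀ t > 0, μ {x | t < g x} ≤ liminf (fun k => μs k {x | t < g x}) atTop) :
    ∫⁻ x, ENNReal.ofReal (g x) ∂μ ≤ liminf (fun k => ∫⁻ x, ENNReal.ofReal (g x) ∂μs k) atTop := by
  have layercake : ∀ ν : Measure X,
      ∫⁻ x, ENNReal.ofReal (g x) ∂ν = ∫⁻ t in Ioi 0, ν {x | t < g x} := fun ν =>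
    lintegral_eq_lintegral_meas_lt ν (Eventually.of_forall hg0) hg.aemeasurable
  simp only [layercake]
  calc ∫⁻ t in Ioi 0, μ {x | t < g x}
      ≤ ∫⁻ t in Ioi 0, liminf (fun k => μs k {x | t < g x}) atTop :=
        setLIntegral_mono' measurableSet_Ioi h
    _ ≤ liminf (fun k => ∫⁻ t in Ioi 0, μs k {x | t < g x}) atTop :=
        lintegral_liminf_le fun k => Antitone.measurable fun s t hst =>
          measure_mono fun x hx => lt_of_le_of_lt hst hx

theorem lintegral_le_liminf_of_superlevel {μs : ℕ → Measure X} {f : X → ℝ≥0∞} (hf : Measurable f)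
    (h : ∀ c < ∞, μ {x | c < f x} ≤ liminf (fun k => μs k {x | c < f x}) atTop) :
    ∫⁻ x, f x ∂μ ≤ liminf (fun k => ∫⁻ x, f x ∂μs k) atTop := by
  have truncated : ∀ N : ℕ,
      ∫⁻ x, min (f x) N ∂μ ≤ liminf (fun k => ∫⁻ x, f x ∂μs k) atTop := by
    intro N
    have hne : ∀ x, min (f x) (N : ℝ≥0∞) ≠ ∞ := fun x =>
      ne_top_of_le_ne_top (ENNReal.natCast_ne_top N) (min_le_right _ _)
    have hreal := lintegral_ofReal_le_liminf_of_superlevel (μ := μ) (μs := μs)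
      (hf.min measurable_const).ennreal_toReal (g := fun x => (min (f x) (N : ℝ≥0∞)).toReal)
      (fun x => ENNReal.toReal_nonneg) fun t ht => by
        simp only [← ENNReal.ofReal_lt_iff_lt_toReal ht.le (hne _), lt_min_iff]
        by_cases htN : ENNReal.ofReal t < N
        · simpa only [htN, and_true] using h _ ENNReal.ofReal_lt_top
        · simp [htN]
    simp only [ENNReal.ofReal_toReal (hne _)] at hreal
    exact hreal.trans (liminf_le_liminf (Eventually.of_forall fun k =>
      lintegral_mono fun x => min_le_left _ _))
  have hsup : ∀ x, f x = ⨆ N : ℕ, min (f x) (N : ℝ≥0∞) := fun x => by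
    rw [← inf_iSup_eq, ENNReal.iSup_natCast, inf_top_eq]
  calc ∫⁻ x, f x ∂μ = ∫⁻ x, ⨆ N : ℕ, min (f x) (N : ℝ≥0∞) ∂μ := lintegral_congr hsup
    _ = ⨆ N : ℕ, ∫⁻ x, min (f x) (N : ℝ≥0∞) ∂μ :=
      lintegral_iSup (fun N => hf.min measurable_const) fun i j hij x =>
        min_le_min_left _ (Nat.cast_le.2 hij)
    _ ≤ liminf (fun k => ∫⁻ x, f x ∂μs k) atTop := iSup_le truncated

theorem measure_compl_le_liminf_of_forall_isOpen [TopologicalSpace X]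
    [TopologicalSpace.PseudoMetrizableSpace X] [BorelSpace X] {ι : Type*} {u : Filter ι} [NeBot u]
    {ν : Measure X} {μs : ι → Measure X} (hν : ∀ k, μs k ≤ ν)
    (h : ∀ U, IsOpen U → μ U ≤ liminf (fun k => μs k U) u)
    {A : Set X} (hA : MeasurableSet A) (hfin : ν A < ∞) :
    μ Aᶜ ≤ liminf (fun k => μs k Aᶜ) u := by
  refine ENNReal.le_of_forall_pos_le_add fun ε hε _ => ?_
  have : IsFiniteMeasure (ν.restrict A) := ⟨by rwa [Measure.restrict_apply_univ]⟩
  obtain ⟨F, hFA, hF, hlt⟩ := hA.exists_isClosed_sdiff_lt (μ := ν.restrict A) (measure_ne_top _ _)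
    (ENNReal.coe_pos.2 hε).ne'
  rw [Measure.restrict_apply (hA.diff hF.measurableSet), inter_eq_left.2 sdiff_subset] at hlt
  have hcover : Fᶜ ⊆ Aᶜ ∪ A \ F := fun x hx => by
    by_cases hxA : x ∈ A
    · exact Or.inr ⟨hxA, hx⟩
    · exact Or.inl hxA
  calc μ Aᶜ ≤ μ Fᶜ := measure_mono (compl_subset_compl.2 hFA)
    _ ≤ liminf (fun k => μs k Fᶜ) u := h _ hF.isOpen_compl
    _ ≤ liminf (fun k => μs k Aᶜ + ε) u := by
      refine liminf_le_liminf (Eventually.of_forall fun k => ?_)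
      calc μs k Fᶜ ≤ μs k Aᶜ + μs k (A \ F) := (measure_mono hcover).trans (measure_union_le _ _)
        _ ≤ μs k Aᶜ + ε := by
          gcongr
          exact (hν k _).trans hlt.le
    _ = liminf (fun k => μs k Aᶜ) u + ε :=
      liminf_add_const u _ _ (by isBoundedDefault) (by isBoundedDefault)

theorem measure_le_sublevel_add_setLIntegral_div {f : X → ℝ≥0∞} (hf : Measurable f) {c : ℝ≥0∞}
    (hc0 : c ≠ 0) (hc : c ≠ ∞) (T : Set X) :
    μ T ≤ μ {x | f x ≤ c} + (∫⁻ x in T, f x ∂μ) / c := by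
  calc μ T = μ.restrict T univ := (Measure.restrict_apply_univ T).symm
    _ ≤ μ.restrict T ({x | f x ≤ c} ∪ {x | c ≤ f x}) :=
      measure_mono fun x _ => le_total (f x) c
    _ ≤ μ.restrict T {x | f x ≤ c} + μ.restrict T {x | c ≤ f x} := measure_union_le _ _
    _ ≤ μ {x | f x ≤ c} + (∫⁻ x in T, f x ∂μ) / c :=
      add_le_add (Measure.restrict_apply_le _ _) (meas_ge_le_lintegral_div hf.aemeasurable hc0 hc)

end MeasureLimits

section WeightedPathDist

variable {X : Type*} [MetricSpace X] [MeasurableSpace X] {Ω : Set X} {ρ : X → ℝ≥0∞}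

/-- The least cost of a Lipschitz path in `Ω` from `x` to `y`, when travelling costs `ρ` per unit of
length. The density is integrated over the image of the path, so that parts that are traversed
several times are paid for once. -/
noncomputable def weightedPathDist [BorelSpace X] (Ω : Set X) (ρ : X → ℝ≥0∞) (x y : X) : ℝ≥0∞ :=
  ⨅ (γ : unitInterval → X) (_ : ∃ K, IsLipschitzPath K Ω x y γ), ∫⁻ z in range γ, ρ z ∂μH[1]

variable [BorelSpace X] {a : ℝ≥0∞}

theorem weightedPathDist_le {K : ℝ≥0} {x y : X} {γ : unitInterval → X}
    (h : IsLipschitzPath K Ω x y γ) :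
    weightedPathDist Ω ρ x y ≤ ∫⁻ z in range γ, ρ z ∂μH[1] :=
  iInf₂_le γ ⟨K, h⟩

theorem weightedPathDist_triangle (x y z : X) :
    weightedPathDist Ω ρ x z ≤ weightedPathDist Ω ρ x y + weightedPathDist Ω ρ y z := by
  conv_rhs => unfold weightedPathDist
  simp only [ENNReal.iInf_add, ENNReal.add_iInf, le_iInf_iff]
  rintro γ₂ ⟨K₂, h₂⟩ γ₁ ⟨K₁, h₁⟩
  obtain ⟨C, γ, hγ⟩ := h₁.in_range.exists_concat h₂.in_range
  calc weightedPathDist Ω ρ x z ≤ ∫⁻ z in range γ, ρ z ∂μH[1] :=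
        weightedPathDist_le (hγ.mono (union_subset h₁.range_subset h₂.range_subset))
    _ ≤ ∫⁻ z in range γ₁ ∪ range γ₂, ρ z ∂μH[1] := lintegral_mono_set hγ.range_subset
    _ ≤ _ := lintegral_union_le _ _ _

theorem weightedPathDist_le_mul_edist {E : Type*} [NormedAddCommGroup E] [NormedSpace ℝ E]
    [MeasurableSpace E] [BorelSpace E] {Ω : Set E} {ρ : E → ℝ≥0∞} (hΩ : Convex ℝ Ω)
    (hρa : ∀ z ∈ Ω, ρ z ≤ a) {x y : E} (hx : x ∈ Ω) (hy : y ∈ Ω) :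
    weightedPathDist Ω ρ x y ≤ a * edist x y := by
  have hpath := IsLipschitzPath.lineMap hΩ hx hy
  calc weightedPathDist Ω ρ x y ≤ _ := weightedPathDist_le hpath
    _ ≤ ∫⁻ _ in range _, a ∂μH[1] :=
      setLIntegral_mono' hpath.isCompact_range.measurableSet fun z hz =>
        hρa z (hpath.range_subset hz)
    _ ≤ a * edist x y := by
      rw [setLIntegral_const, edist_nndist]
      gcongr
      exact hausdorffMeasure_one_range_le hpath.lipschitzWith

theorem continuousOn_of_triangle_of_le_mul_edist {X : Type*} [PseudoEMetricSpace X] {Ω : Set X}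
    {d : X → X → ℝ≥0∞} (ha : a ≠ ∞) (htri : ∀ x y z, d x z ≤ d x y + d y z)
    (hle : ∀ x ∈ Ω, ∀ y ∈ Ω, d x y ≤ a * edist x y) :
    ContinuousOn (fun p : X × X => d p.1 p.2) (Ω ×ˢ Ω) := by
  rw [continuousOn_iff_continuous_domRestrict]
  refine continuous_of_le_add_edist (a * 2) (ENNReal.mul_ne_top ha (by simp)) ?_
  rintro ⟨⟨x, y⟩, hx, hy⟩ ⟨⟨x', y'⟩, hx', hy'⟩
  have hedist₁ : edist x x' ≤ edist (x, y) (x', y') := le_max_left _ _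
  have hedist₂ : edist y' y ≤ edist (x, y) (x', y') := edist_comm y' y ▸ le_max_right _ _
  calc d x y ≤ d x x' + (d x' y' + d y' y) := (htri x x' y).trans (by gcongr; exact htri _ _ _)
    _ ≤ a * edist (x, y) (x', y') + (d x' y' + a * edist (x, y) (x', y')) := by
        gcongr
        · exact (hle x hx x' hx').trans (by gcongr)
        · exact (hle y' hy' y hy).trans (by gcongr)
    _ = d x' y' + a * 2 * edist (x, y) (x', y') := by ring

theorem exists_constant_speed_of_weightedPathDist_lt {x y : X} {c : ℝ≥0∞}
    (h : weightedPathDist Ω ρ x y < c) :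
    ∃ γ, IsLipschitzPath (μH[1] (range γ)).toNNReal Ω x y γ ∧
      ∫⁻ z in range γ, ρ z ∂μH[1] < c := by
  simp only [weightedPathDist, iInf_lt_iff] at h
  obtain ⟨γ, ⟨K, hγ⟩, hcost⟩ := h
  obtain ⟨η, hη⟩ := hγ.exists_constant_speed
  exact ⟨η, hη.mono hγ.range_subset, (lintegral_mono_set hη.range_subset).trans_lt hcost⟩

theorem setLIntegral_range_le_liminf (hρ : Measurable ρ) (hρa : ∀ z, ρ z ≤ a)
    (hfin : ∀ c < a, μH[1] {z | ρ z ≤ c} < ∞) {l : ℕ → ℝ≥0} {l₀ : ℝ≥0}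
    {γs : ℕ → unitInterval → X} {γ : unitInterval → X} (hγs : ∀ k, LipschitzWith (l k) (γs k))
    (hl : ∀ k, l k ≤ μH[1] (range (γs k))) (hlim : Tendsto l atTop (𝓝 l₀))
    (hγ : LipschitzWith l₀ γ) (hu : TendstoUniformly γs γ atTop) :
    ∫⁻ z in range γ, ρ z ∂μH[1] ≤ liminf (fun k => ∫⁻ z in range (γs k), ρ z ∂μH[1]) atTop := by
  refine lintegral_le_liminf_of_superlevel hρ fun c _ => ?_
  rcases lt_or_ge c a with hca | hca
  · have hcompl : {z | c < ρ z} = {z | ρ z ≤ c}ᶜ := by ext; simp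
    rw [hcompl]
    refine measure_compl_le_liminf_of_forall_isOpen (ν := μH[1])
      (fun k => Measure.restrict_le_self) (fun U hU => ?_)
      (measurableSet_le hρ measurable_const) (hfin c hca)
    simpa only [Measure.restrict_apply hU.measurableSet, inter_comm U] using
      hausdorffMeasure_one_range_inter_le_liminf hγs hl hlim hγ hu hU
  · simp [fun z => ((hρa z).trans hca).not_gt]

theorem weightedPathDist_le_of_tendsto [ProperSpace X] (hΩ : IsClosed Ω) (ha : 0 < a)
    (hρ : Measurable ρ) (hρa : ∀ z, ρ z ≤ a) (hfin : ∀ c < a, μH[1] {z | ρ z ≤ c} < ∞)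
    {x y : X} {p q : ℕ → X} (hp : Tendsto p atTop (𝓝 x)) (hq : Tendsto q atTop (𝓝 y))
    {c : ℝ≥0∞} (hc : c ≠ ∞) (hlt : ∀ k, weightedPathDist Ω ρ (p k) (q k) < c) :
    weightedPathDist Ω ρ x y ≤ c := by
  choose γs hγs hcost using fun k => exists_constant_speed_of_weightedPathDist_lt (hlt k)
  obtain ⟨r, hr0, hra⟩ := exists_between ha
  have hbound_ne_top : μH[1] {z | ρ z ≤ r} + c / r ≠ ∞ :=
    ENNReal.add_ne_top.2 ⟨(hfin r hra).ne, ENNReal.div_ne_top hc hr0.ne'⟩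
  have hlength : ∀ k, μH[1] (range (γs k)) ≤ μH[1] {z | ρ z ≤ r} + c / r := fun k =>
    (measure_le_sublevel_add_setLIntegral_div hρ hr0.ne' hra.ne_top _).trans
      (by gcongr; exact (hcost k).le)
  obtain ⟨φ, l₀, γ, hlim, hu, hγ⟩ := exists_subseq_tendstoUniformly_of_isLipschitzPath hΩ
    (fun k => ENNReal.toNNReal_mono hbound_ne_top (hlength k)) hp hq hγs
  calc weightedPathDist Ω ρ x y ≤ ∫⁻ z in range γ, ρ z ∂μH[1] := weightedPathDist_le hγ
    _ ≤ liminf (fun k => ∫⁻ z in range (γs (φ k)), ρ z ∂μH[1]) atTop :=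
      setLIntegral_range_le_liminf hρ hρa hfin (fun k => (hγs (φ k)).lipschitzWith)
        (fun k => ENNReal.coe_toNNReal_le_self) hlim hγ.lipschitzWith hu
    _ ≤ liminf (fun _ : ℕ => c) atTop :=
      liminf_le_liminf (Eventually.of_forall fun k => (hcost (φ k)).le)
    _ = c := liminf_const c

theorem lowerSemicontinuous_weightedPathDist [ProperSpace X] (hΩ : IsClosed Ω) (ha : 0 < a)
    (hρ : Measurable ρ) (hρa : ∀ z, ρ z ≤ a) (hfin : ∀ c < a, μH[1] {z | ρ z ≤ c} < ∞) :
    LowerSemicontinuous fun p : X × X => weightedPathDist Ω ρ p.1 p.2 := by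
  rw [lowerSemicontinuous_iff_isClosed_preimage]
  refine fun c => IsSeqClosed.isClosed fun p p₀ hpc hp => ?_
  refine le_of_forall_gt_imp_ge_of_dense (α := ℝ≥0∞) fun c' hc' => ?_
  rcases eq_or_ne c' ∞ with rfl | hc'_top
  · exact le_top
  · exact weightedPathDist_le_of_tendsto hΩ ha hρ hρa hfin ((continuous_fst.tendsto _).comp hp)
      ((continuous_snd.tendsto _).comp hp) hc'_top fun k => (hpc k).trans_lt hc'

end WeightedPathDist

section UrbanMetric

/-- The cost per unit of length underlying the urban metric: `b` on the network `S` and `a` off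
it. -/
noncomputable def urbanDensity {α : Type*} (S : Set α) (a : ℝ≥0∞) (b : α → ℝ≥0∞) : α → ℝ≥0∞ :=
  open Classical in S.piecewise b fun _ => a

theorem urbanDensity_le {α : Type*} {S : Set α} {a : ℝ≥0∞} {b : α → ℝ≥0∞}
    (hba : ∀ z ∈ S, b z ≤ a) (z : α) : urbanDensity S a b z ≤ a := by
  by_cases hz : z ∈ S <;> simp [urbanDensity, hz, hba]

theorem setOf_urbanDensity_le {α : Type*} {S : Set α} {a c : ℝ≥0∞} (b : α → ℝ≥0∞) (hc : c < a) :
    {z | urbanDensity S a b z ≤ c} = {z ∈ S | b z ≤ c} := by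
  ext z
  by_cases hz : z ∈ S <;> simp [urbanDensity, hz, hc]

theorem measurable_urbanDensity {α : Type*} [TopologicalSpace α] [MeasurableSpace α] [BorelSpace α]
    {S : Set α} {b : α → ℝ≥0∞} (hS : MeasurableSet S) (hb : LowerSemicontinuousOn b S) (a : ℝ≥0∞) :
    Measurable (urbanDensity S a b) := by
  refine measurable_of_restrict_of_restrict_compl hS ?_ ?_
  · rw [urbanDensity, domRestrict_piecewise]
    exact (lowerSemicontinuous_restrict_iff.2 hb).measurable
  · rw [urbanDensity, domRestrict_piecewise_compl]
    exact measurable_const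

variable {n : ℕ} {Ω S : Set (EuclideanSpace ℝ (Fin n))} {a : ℝ≥0∞}
  {b : EuclideanSpace ℝ (Fin n) → ℝ≥0∞}

theorem travelCost_eq_setLIntegral_urbanDensity (hS : MeasurableSet S)
    (T : Set (EuclideanSpace ℝ (Fin n))) :
    travelCost S a b T = ∫⁻ z in T, urbanDensity S a b z ∂μH[1] := by
  rw [urbanDensity, lintegral_piecewise hS, Measure.restrict_restrict hS,
    Measure.restrict_restrict hS.compl, setLIntegral_const, inter_comm S, inter_comm Sᶜ,
    ← sdiff_eq, travelCost]

theorem urbanMetric_eq_weightedPathDist (hS : MeasurableSet S) (x y : EuclideanSpace ℝ (Fin n)) :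
    urbanMetric Ω S a b x y = weightedPathDist Ω (urbanDensity S a b) x y := by
  have hmem : ∀ γ, γ ∈ lipschitzPaths Ω x y ↔ ∃ K, IsLipschitzPath K Ω x y γ := fun γ =>
    ⟨fun ⟨⟨K, hK⟩, hΩ, h0, h1⟩ => ⟨K, hK, hΩ, h0, h1⟩,
      fun ⟨K, hK, hΩ, h0, h1⟩ => ⟨⟨K, hK⟩, hΩ, h0, h1⟩⟩
  simp only [urbanMetric, weightedPathDist, hmem, travelCost_eq_setLIntegral_urbanDensity hS]

theorem mainTheorem8_general (hS_borel : MeasurableSet S) (hb_lsc : LowerSemicontinuousOn b S)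
    (hba : ∀ z ∈ S, b z ≤ a) :
    (Convex ℝ Ω → a < ∞ →
      ContinuousOn
        (fun p : EuclideanSpace ℝ (Fin n) × EuclideanSpace ℝ (Fin n) =>
          urbanMetric Ω S a b p.1 p.2) (Ω ×ˢ Ω)) ∧
    (IsClosed Ω → 0 < a → FiniteSublevels S a b →
      LowerSemicontinuous
        (fun p : EuclideanSpace ℝ (Fin n) × EuclideanSpace ℝ (Fin n) =>
          urbanMetric Ω S a b p.1 p.2)) := by
  simp only [urbanMetric_eq_weightedPathDist hS_borel]
  refine ⟨fun hΩ ha => ?_, fun hΩ ha hfin => ?_⟩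
  · exact continuousOn_of_triangle_of_le_mul_edist ha.ne weightedPathDist_triangle
      fun x hx y hy => weightedPathDist_le_mul_edist hΩ (fun z _ => urbanDensity_le hba z) hx hy
  · exact lowerSemicontinuous_weightedPathDist hΩ ha (measurable_urbanDensity hS_borel hb_lsc a)
      (urbanDensity_le hba) fun c hc => by
        rw [setOf_urbanDensity_le b hc]
        exact hfin c hc

end UrbanMetric

theorem mainTheorem8 (n : ℕ) (Ω S : Set (EuclideanSpace ℝ (Fin n)))
    (hΩ_closed : IsClosed Ω) (hΩ_convex : Convex ℝ Ω)
    (hSΩ : S ⊆ Ω) (hS_rect : IsCountablyOneRectifiable S) (hS_borel : MeasurableSet S)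
    (a : ℝ≥0∞) (b : EuclideanSpace ℝ (Fin n) → ℝ≥0∞)
    (hb_lsc : LowerSemicontinuousOn b S) (hba : ∀ z ∈ S, b z ≤ a) :
    (a < ∞ →
      ContinuousOn
        (fun p : EuclideanSpace ℝ (Fin n) × EuclideanSpace ℝ (Fin n) =>
          urbanMetric Ω S a b p.1 p.2) (Ω ×ˢ Ω)) ∧
    (a = ∞ → FiniteSublevels S a b →
      LowerSemicontinuousOn
        (fun p : EuclideanSpace ℝ (Fin n) × EuclideanSpace ℝ (Fin n) =>
          urbanMetric Ω S a b p.1 p.2) (Ω ×ˢ Ω)) := by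
  obtain ⟨hcont, hlsc⟩ := mainTheorem8_general (Ω := Ω) hS_borel hb_lsc hba
  exact ⟨hcont hΩ_convex, fun ha hfin =>
    (hlsc hΩ_closed (ha ▸ ENNReal.zero_lt_top) hfin).lowerSemicontinuousOn _⟩
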